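/- Define polynomials by $Q_0(x)=1$ and $Q_n(x)=x\sum_{k=1}^{n}k\,Q_{n-k}(x)$ for $n\ge 1$, and write $Q_n(x)=\sum_{k=0}^{n}A_{n,k}x^k$ (so that $A_{n,k}=\binom{n+k-1}{2k-1}$ for $1\le k\le n$). Let $X_n$ be a random variable with values in $\{0,1,\dots,n\}$ and $P(X_n=k)=A_{n,k}/\sum_{m=0}^{n}A_{n,m}$, let $\mu_n=\mathbb E(X_n)$ and $\sigma_n=\sqrt{\mathbb V(X_n)}$, let $F_m$ be the Fibonacci numbers ($F_0=0$, $F_1=1$), and let $\varphi(x)=\frac{1}{\sqrt{2\pi}}e^{-x^2/2}$. Then $$A_{n,k}\sim F_{2n}\,\frac{\varphi(x)}{\sigma_n}\qquad(n\to\infty),\qquad k=\mu_n+x\sigma_n,\ x \text{ bounded}.$$ That is, for all $M\geq 0$ and $\varepsilon>0$ there is $N$ such that for all $n\ge N$ and all real $x$ with $|x|\le M$ for which $k=\mu_n+x\sigma_n$ is a non-negative integer, $$\left|\frac{A_{n,k}}{F_{2n}\,\varphi(x)/\sigma_n}-1\right|\le\varepsilon .$$ The same estimate holds, uniformly for all real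 $x$ with $|x|\le M$, with $k=\lfloor\mu_n+x\sigma_n\rfloor$. -/

import Mathlib

namespace MorganVoyce

/-- The polynomials `Q_n`, given by `Q_0 = 1` and `Q_n(x) = x * ∑_{k=1}^n k * Q_{n-k}(x)`.
In the code the summation index is `j = k - 1`, running over `0, …, n - 1`. -/
noncomputable def Q : ℕ → Polynomial ℕ
  | 0 => 1
  | n + 1 => Polynomial.X * ∑ j : Fin (n + 1), Polynomial.C ((j : ℕ) + 1) * Q (n - (j : ℕ))
termination_by n => n
decreasing_by omega

/-- The coefficients `A_{n,k}`, i.e. `Q_n(x) = ∑_{k=0}^n A_{n,k} x^k`. -/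
noncomputable def A (n k : ℕ) : ℕ := (Q n).coeff k

/-- The distribution of the random variable `X_n` with values in `{0, …, n}`:
`P(X_n = k) = A_{n,k} / ∑_{m=0}^n A_{n,m}`. -/
noncomputable def prob (n k : ℕ) : ℝ :=
  (A n k : ℝ) / ∑ m ∈ Finset.range (n + 1), (A n m : ℝ)

/-- The expected value `μ_n = E(X_n)`. -/
noncomputable def mean (n : ℕ) : ℝ :=
  ∑ k ∈ Finset.range (n + 1), (k : ℝ) * prob n k

/-- The variance `σ_n² = V(X_n)`. -/
noncomputable def variance (n : ℕ) : ℝ :=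
  ∑ k ∈ Finset.range (n + 1), ((k : ℝ) - mean n) ^ 2 * prob n k

/-- The standard deviation `σ_n`. -/
noncomputable def sigma (n : ℕ) : ℝ := Real.sqrt (variance n)

/-- The density `φ(x) = exp(-x²/2) / √(2π)` of the standard normal distribution. -/
noncomputable def phi (x : ℝ) : ℝ :=
  Real.exp (-x ^ 2 / 2) / Real.sqrt (2 * Real.pi)

end MorganVoyce

namespace MorganVoyce

open Finset Filter Topology MeasureTheory

/-! The closed form gives `A n (k+1) / A n k = (n² - k²) / (2k(2k+1))`, which crosses 1 near `k =
n/√5`. With `t = k - n/√5`, the logarithm of this ratio is `-(5√5/2) t/n + O(1/n)` while `t =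
O(√n)`. Summation gives `A n k ≈ A n c * exp(-b t²/n)`, where `b = 5√5/4` and `c` is the centre
(`eventually_abs_log_A_sub_log_A_center_le`).

The constants then follow from this shape, without Stirling's formula or exact moments. A cruder
Gaussian bound for all `1 ≤ k ≤ n` (`A_le_exp_mul`) allows dominated convergence, so the moments of
order 0, 1, 2 about `n/√5`, scaled by `A n c` and `√n`, tend to Gaussian integrals
(`tendsto_scaledMoment`). Since the coefficients sum to `F_{2n}`, order 0 gives `F_{2n} ~ A n c *
√(πn/b)`; order 1 gives `μ_n = n/√5 + o(√n)`; order 2 gives `σ_n² ~ n/(2b)`. For `k` within 1 of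
`μ_n + x σ_n`, `b t²/n` tends to `x²/2` uniformly in bounded `x`, and the prefactors agree
(`tendsto_log_normalization`). -/

/-! ### Closed form of the coefficients and their sum -/

theorem sum_succ_mul_reflect_succ (a : ℕ → ℕ) (n : ℕ) :
    ∑ j ∈ range (n + 2), (j + 1) * a (n + 1 - j) =
      ∑ j ∈ range (n + 1), (j + 1) * a (n - j) + ∑ m ∈ range (n + 2), a m := by
  rw [sum_range_succ', sum_range_succ a (n + 1), ← sum_range_reflect a (n + 1), ← add_assoc,
    ← sum_add_distrib]
  congr 1
  · refine sum_congr rfl fun j _ => ?_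
    rw [show n + 1 - (j + 1) = n - j by omega, show n + 1 - 1 - j = n - j by omega]
    ring
  · simp

theorem Q_zero : Q 0 = 1 := by rw [Q]

theorem Q_succ (n : ℕ) :
    Q (n + 1) = Polynomial.X * ∑ j ∈ range (n + 1), Polynomial.C (j + 1) * Q (n - j) := by
  rw [Q, ← Fin.sum_univ_eq_sum_range (fun j => Polynomial.C (j + 1) * Q (n - j))]

theorem A_zero_succ (k : ℕ) : A 0 (k + 1) = 0 := by
  simp [A, Q_zero, Polynomial.coeff_one]

theorem A_zero_zero : A 0 0 = 1 := by simp [A, Q_zero]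

theorem A_succ_zero (n : ℕ) : A (n + 1) 0 = 0 := by
  simp [A, Q_succ]

theorem A_succ_succ (n k : ℕ) :
    A (n + 1) (k + 1) = ∑ j ∈ range (n + 1), (j + 1) * A (n - j) k := by
  simp only [A, Q_succ, Polynomial.coeff_X_mul, Polynomial.finsetSum_coeff,
    Polynomial.coeff_C_mul]

theorem A_succ_one (n : ℕ) : A (n + 1) 1 = n + 1 := by
  rw [A_succ_succ, sum_range_succ, sum_eq_zero, Nat.sub_self, A_zero_zero]
  · simp
  · intro j hj
    obtain ⟨m, hm⟩ : ∃ m, n - j = m + 1 := ⟨n - j - 1, by have := mem_range.1 hj; omega⟩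
    rw [hm, A_succ_zero, mul_zero]

/-- Raising `n` by one raises every weight in the convolution by one, so the increment is a plain
partial sum of the previous column. The hockey-stick identity evaluates that sum, and Pascal's rule
closes the induction. -/
theorem A_eq_choose (n k : ℕ) : A (n + 1) (k + 1) = (n + k + 1).choose (2 * k + 1) := by
  induction k generalizing n with
  | zero => simp [A_succ_one]
  | succ k ih =>
    have hsum : ∀ n, ∑ m ∈ range (n + 1), A m (k + 1) = (n + k + 1).choose (2 * k + 2) := by
      intro n
      induction n with
      | zero =>
        simp only [zero_add, range_one, sum_singleton, A_zero_succ]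
        rw [Nat.choose_eq_zero_of_lt (by omega)]
      | succ n ihn =>
        rw [sum_range_succ, ihn, ih, show n + 1 + k + 1 = (n + k + 1) + 1 by ring,
          Nat.choose_succ_succ' (n + k + 1) (2 * k + 1)]
        ring
    induction n with
    | zero =>
      rw [A_succ_succ, Nat.choose_eq_zero_of_lt (by omega)]
      simp [A_zero_succ]
    | succ n ihn =>
      rw [A_succ_succ, sum_succ_mul_reflect_succ (fun i => A i (k + 1)), ← A_succ_succ, ihn, hsum,
        show n + 1 + (k + 1) + 1 = (n + 1 + k + 1) + 1 by ring,
        show 2 * (k + 1) + 1 = (2 * k + 2) + 1 by ring, Nat.choose_succ_succ' (n + 1 + k + 1),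
        show n + (k + 1) + 1 = n + 1 + k + 1 by ring]
      ring

theorem A_zero_right {n : ℕ} (hn : 1 ≤ n) : A n 0 = 0 := by
  obtain ⟨n, rfl⟩ := Nat.exists_eq_add_of_le' hn
  exact A_succ_zero n

theorem A_eq_zero_of_lt {n k : ℕ} (h : n < k) : A n k = 0 := by
  obtain ⟨k, rfl⟩ := Nat.exists_eq_add_of_lt (Nat.zero_lt_of_lt h)
  rw [zero_add] at *
  cases n with
  | zero => exact A_zero_succ k
  | succ n => rw [A_eq_choose, Nat.choose_eq_zero_of_lt (by omega)]

theorem A_pos {n k : ℕ} (hk : 1 ≤ k) (hkn : k ≤ n) : 0 < A n k := by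
  obtain ⟨k, rfl⟩ := Nat.exists_eq_add_of_le' hk
  obtain ⟨n, rfl⟩ := Nat.exists_eq_add_of_le' (hk.trans hkn)
  rw [A_eq_choose]
  exact Nat.choose_pos (by omega)

/-- Apart from positivity and vanishing outside `1 ≤ k ≤ n`, the size estimates use the closed form
only through this ratio. -/
theorem A_succ_mul {n k : ℕ} (hk : 1 ≤ k) (hkn : k ≤ n) :
    (A n (k + 1) : ℝ) * (2 * k * (2 * k + 1)) = A n k * ((n : ℝ) ^ 2 - (k : ℝ) ^ 2) := by
  obtain ⟨k, rfl⟩ := Nat.exists_eq_add_of_le' hk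
  obtain ⟨d, rfl⟩ := Nat.exists_eq_add_of_le hkn
  rw [show k + 1 + d = (k + d) + 1 by ring, A_eq_choose, A_eq_choose]
  have h1 := Nat.add_one_mul_choose_eq (k + d + k + 1) (2 * k + 2)
  have h2 := Nat.choose_succ_right_eq (k + d + k + 1) (2 * k + 1)
  rw [show k + d + k + 1 - (2 * k + 1) = d by omega] at h2
  have h1' : ((k + d + k + 1 + 1 : ℕ) : ℝ) * ((k + d + k + 1).choose (2 * k + 2) : ℝ) =
      ((k + d + (k + 1) + 1).choose (2 * (k + 1) + 1) : ℝ) * ((2 * k + 3 : ℕ) : ℝ) := by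
    exact_mod_cast h1
  have h2' : ((k + d + k + 1).choose (2 * k + 2) : ℝ) * ((2 * k + 2 : ℕ) : ℝ) =
      ((k + d + k + 1).choose (2 * k + 1) : ℝ) * (d : ℝ) := by
    exact_mod_cast h2
  push_cast at *
  linear_combination (-(2 * (k : ℝ) + 2)) * h1' + ((k : ℝ) + d + k + 1 + 1) * h2'

theorem sum_A {n : ℕ} (hn : 1 ≤ n) : ∑ k ∈ range (n + 1), A n k = Nat.fib (2 * n) := by
  have hev : ∀ n, (Q n).eval 1 = ∑ k ∈ range (n + 1), A n k := by
    intro n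
    have hdeg : (Q n).natDegree < n + 1 :=
      Nat.lt_succ_of_le (Polynomial.natDegree_le_iff_coeff_eq_zero.2 fun k hk => A_eq_zero_of_lt hk)
    rw [Polynomial.eval_eq_sum_range' hdeg]
    simp [A]
  have hrec : ∀ n, (Q (n + 1)).eval 1 = ∑ j ∈ range (n + 1), (j + 1) * (Q (n - j)).eval 1 := by
    intro n
    simp only [Q_succ, Polynomial.eval_mul, Polynomial.eval_X, one_mul, Polynomial.eval_finsetSum]
    simp
  -- The values at 1 and their partial sums interlace as even- and odd-indexed Fibonacci numbers, so
  -- both are proved together.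
  have key : ∀ n, (Q (n + 1)).eval 1 = Nat.fib (2 * n + 2) ∧
      ∑ m ∈ range (n + 2), (Q m).eval 1 = Nat.fib (2 * n + 3) := by
    intro n
    induction n with
    | zero => simp [sum_range_succ, Q_succ, Q_zero, Nat.fib]
    | succ n ih =>
      have h1 : (Q (n + 2)).eval 1 = Nat.fib (2 * (n + 1) + 2) := by
        rw [hrec, sum_succ_mul_reflect_succ (fun i => (Q i).eval 1), ← hrec, ih.1, ih.2,
          show 2 * (n + 1) + 2 = (2 * n + 2) + 2 by ring, Nat.fib_add_two (n := 2 * n + 2)]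
      refine ⟨h1, ?_⟩
      rw [sum_range_succ, ih.2, h1, show 2 * (n + 1) + 3 = (2 * n + 3) + 2 by ring,
        Nat.fib_add_two (n := 2 * n + 3), add_comm]
      exact add_comm _ _
  obtain ⟨n, rfl⟩ := Nat.exists_eq_add_of_le' hn
  rw [← hev, (key n).1]
  rfl

/-! ### The centre of the distribution -/

/-- The distance of `k` from the approximate centre `n / √5` of the distribution. -/
noncomputable def deviation (n k : ℕ) : ℝ := k - √5 / 5 * n

/-- The least integer that is at least `n / √5`. -/
noncomputable def center (n : ℕ) : ℕ := ⌈√5 / 5 * (n : ℝ)⌉₊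

theorem sq_sqrt_five : √5 ^ 2 = (5 : ℝ) := Real.sq_sqrt (by norm_num)

theorem lt_sqrt_five : (2.2 : ℝ) < √5 := Real.lt_sqrt_of_sq_lt (by norm_num)

theorem sqrt_five_lt : √5 < (2.25 : ℝ) := by
  rw [Real.sqrt_lt' (by norm_num)]; norm_num

theorem deviation_succ (n k : ℕ) : deviation n (k + 1) = deviation n k + 1 := by
  simp only [deviation]; push_cast; ring

theorem deviation_center_nonneg (n : ℕ) : 0 ≤ deviation n (center n) := by
  have := Nat.le_ceil (√5 / 5 * (n : ℝ))
  simp only [deviation, center]; linarith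

theorem deviation_center_le_one (n : ℕ) : deviation n (center n) ≤ 1 := by
  have := Nat.ceil_lt_add_one (show 0 ≤ √5 / 5 * (n : ℝ) by positivity)
  simp only [deviation, center]; linarith

theorem one_le_center {n : ℕ} (hn : 1 ≤ n) : 1 ≤ center n := by
  have : (1 : ℝ) ≤ n := by exact_mod_cast hn
  exact Nat.one_le_ceil_iff.2 (by positivity)

theorem center_le (n : ℕ) : center n ≤ n := by
  refine Nat.ceil_le.2 ?_
  have := sqrt_five_lt
  have : (0 : ℝ) ≤ n := by positivity
  nlinarith

/-- The ratio of consecutive coefficients minus 1 has numerator `n² - 5k² - 2k`; its leading part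
vanishes at `k = n/√5`, which fixes the centre. -/
theorem sq_sub_five_mul_sq (n k : ℕ) :
    (n : ℝ) ^ 2 - 5 * (k : ℝ) ^ 2 = -2 * √5 * n * deviation n k - 5 * deviation n k ^ 2 := by
  have := sq_sqrt_five
  simp only [deviation]
  linear_combination ((n : ℝ) ^ 2 / 5) * this - 2 * (n : ℝ) ^ 2 / 5 * this

/-! ### Increments of the logarithm and the local Gaussian shape -/

theorem log_A_succ {n k : ℕ} (hk : 1 ≤ k) (hkn : k < n) :
    Real.log (A n (k + 1)) - Real.log (A n k) =
      Real.log (((n : ℝ) ^ 2 - (k : ℝ) ^ 2) / (2 * k * (2 * k + 1))) := by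
  have h := A_succ_mul hk hkn.le
  have hk' : (0 : ℝ) < k := by exact_mod_cast hk
  have h1 : (A n (k + 1) : ℝ) ≠ 0 := by exact_mod_cast (A_pos (by omega) (by omega)).ne'
  have h2 : (A n k : ℝ) ≠ 0 := by exact_mod_cast (A_pos hk hkn.le).ne'
  rw [← Real.log_div h1 h2]
  congr 1
  rw [div_eq_div_iff h2 (by positivity), h]
  ring

/-- This bound is `log r ≤ r - 1` and the next one is `1 - 1/r ≤ log r`; they share a numerator and
differ only in the denominator. -/
theorem log_A_succ_sub_le {n k : ℕ} (hk : 1 ≤ k) (hkn : k < n) :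
    Real.log (A n (k + 1)) - Real.log (A n k) ≤
      ((n : ℝ) ^ 2 - 5 * (k : ℝ) ^ 2 - 2 * k) / (2 * k * (2 * k + 1)) := by
  rw [log_A_succ hk hkn]
  have hk' : (0 : ℝ) < k := by exact_mod_cast hk
  have hn' : (k : ℝ) < n := by exact_mod_cast hkn
  have hpos : 0 < (n : ℝ) ^ 2 - (k : ℝ) ^ 2 := by nlinarith
  refine (Real.log_le_sub_one_of_pos (by positivity)).trans (le_of_eq ?_)
  field_simp
  ring

theorem le_log_A_succ_sub {n k : ℕ} (hk : 1 ≤ k) (hkn : k < n) :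
    ((n : ℝ) ^ 2 - 5 * (k : ℝ) ^ 2 - 2 * k) / ((n : ℝ) ^ 2 - (k : ℝ) ^ 2) ≤
      Real.log (A n (k + 1)) - Real.log (A n k) := by
  rw [log_A_succ hk hkn]
  have hk' : (0 : ℝ) < k := by exact_mod_cast hk
  have hn' : (k : ℝ) < n := by exact_mod_cast hkn
  have hpos : 0 < (n : ℝ) ^ 2 - (k : ℝ) ^ 2 := by nlinarith
  refine le_trans (le_of_eq ?_) (Real.one_sub_inv_le_log_of_pos (by positivity))
  field_simp
  ring

theorem sub_le_mul_of_forall_step {g : ℕ → ℝ} {δ : ℝ} {k l : ℕ} (hkl : k ≤ l)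
    (h : ∀ i, k ≤ i → i < l → g (i + 1) - g i ≤ δ) : g l - g k ≤ (l - k : ℝ) * δ := by
  induction l, hkl using Nat.le_induction with
  | base => simp
  | succ l hl ih =>
    have h1 := ih fun i hi hil => h i hi (by omega)
    have h2 := h l hl (by omega)
    push_cast
    linarith

theorem bounds_of_abs_deviation_le {n k : ℕ} (hn : 3 ≤ n) (h : |deviation n k| ≤ n / 10) :
    (n : ℝ) / 3 ≤ k ∧ (k : ℝ) ≤ 3 / 5 * n ∧ 1 ≤ k ∧ k < n := by
  have hn' : (3 : ℝ) ≤ n := by exact_mod_cast hn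
  obtain ⟨h1, h2⟩ := abs_le.1 h
  simp only [deviation] at h1 h2
  have h3 := lt_sqrt_five
  have h4 := sqrt_five_lt
  have h5 : (n : ℝ) / 3 ≤ k := by nlinarith
  have h6 : (k : ℝ) ≤ 3 / 5 * n := by nlinarith
  refine ⟨h5, h6, ?_, ?_⟩
  · have : (1 : ℝ) ≤ k := by linarith
    exact_mod_cast this
  · have : (k : ℝ) < n := by linarith
    exact_mod_cast this

/-- Both denominators are close to `4n²/5`, so the main term is `-2√5 n t / (4n²/5) = -(5√5/2) t/n`.
The constants 41 and 9 are not sharp. -/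
theorem abs_log_A_succ_sub_add_le {n k : ℕ} {J : ℝ} (hn : 3 ≤ n)
    (h : |deviation n k| ≤ n / 10) (hJ : deviation n k ^ 2 ≤ J ^ 2 * n) :
    |Real.log (A n (k + 1)) - Real.log (A n k) + 5 * √5 / 2 * deviation n k / n| ≤
      (41 * J ^ 2 + 9) / n := by
  obtain ⟨hk1, hk2, hk3, hk4⟩ := bounds_of_abs_deviation_le hn h
  have hn0 : (0 : ℝ) < n := by have : (3 : ℝ) ≤ n := by exact_mod_cast hn
                               linarith
  have hk0 : (0 : ℝ) < k := by linarith
  have hup := log_A_succ_sub_le hk3 hk4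
  have hlo := le_log_A_succ_sub hk3 hk4
  rw [sq_sub_five_mul_sq] at hup hlo
  have hkd : (k : ℝ) = √5 / 5 * n + deviation n k := by simp [deviation]
  have h5 := sq_sqrt_five
  have h5l := lt_sqrt_five
  have h5u := sqrt_five_lt
  set t := deviation n k with ht
  set q := √5 with hq
  set v : ℝ := t / n with hv
  have htv : t = v * n := by rw [hv]; field_simp
  have hv1 : |v| ≤ 1 / 10 := by
    rw [hv, abs_div, abs_of_pos hn0, div_le_iff₀ hn0]; linarith
  obtain ⟨hvl, hvu⟩ := abs_le.1 hv1
  have hq0 : 0 < q := by linarith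
  have hqv : |q * v| ≤ 0.225 := by
    rw [abs_mul, abs_of_pos hq0]
    nlinarith [abs_nonneg v]
  obtain ⟨hqvl, hqvu⟩ := abs_le.1 hqv
  have ht2 : 0 ≤ t ^ 2 := sq_nonneg t
  have hJn : 0 ≤ J ^ 2 * n := by positivity
  have hqt : q * v * t ^ 2 ≤ 0.225 * t ^ 2 := mul_le_mul_of_nonneg_right hqvu ht2
  have hqk : q * v * k ≤ 0.225 * k := mul_le_mul_of_nonneg_right hqvu hk0.le
  rw [abs_le]
  constructor
  · have hden : 0 < (n : ℝ) ^ 2 - (k : ℝ) ^ 2 := by nlinarith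
    have hden' : (n : ℝ) ^ 2 / 2 ≤ (n : ℝ) ^ 2 - (k : ℝ) ^ 2 := by nlinarith
    -- After substituting for `n² - k²`, the main terms `n * t` cancel exactly; the rest is of order
    -- `t² + k`, hence of order `(J² + 1) n`.
    have hid : (-2 * q * n * t - 5 * t ^ 2 - 2 * k) + 5 * q / 2 * t / n * ((n : ℝ) ^ 2 - (k : ℝ) ^ 2)
        = -10 * t ^ 2 - 2 * k - 5 / 2 * (q * v) * t ^ 2 := by
      rw [mul_div_assoc, ← hv, hkd, htv]
      linear_combination (-(n : ℝ) ^ 2 * v ^ 2 - q * v * (n : ℝ) ^ 2 / 10) * h5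
    have hnum : -(41 * J ^ 2 + 9) / n * ((n : ℝ) ^ 2 - (k : ℝ) ^ 2) ≤
        (-2 * q * n * t - 5 * t ^ 2 - 2 * k)
          + 5 * q / 2 * t / n * ((n : ℝ) ^ 2 - (k : ℝ) ^ 2) := by
      rw [hid]
      have : (41 * J ^ 2 + 9) / n * ((n : ℝ) ^ 2 / 2) ≤
          (41 * J ^ 2 + 9) / n * ((n : ℝ) ^ 2 - (k : ℝ) ^ 2) := by gcongr
      have e : (41 * J ^ 2 + 9) / n * ((n : ℝ) ^ 2 / 2) = (41 * J ^ 2 + 9) * n / 2 := by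
        field_simp
      have : -(41 * J ^ 2 + 9) / n * ((n : ℝ) ^ 2 - (k : ℝ) ^ 2) ≤ -((41 * J ^ 2 + 9) * n / 2) := by
        rw [neg_div, neg_mul]; linarith
      linarith
    have := (le_div_iff₀ hden).2 (by linarith :
      (-(41 * J ^ 2 + 9) / n - 5 * q / 2 * t / n) * ((n : ℝ) ^ 2 - (k : ℝ) ^ 2) ≤
        (-2 * q * n * t - 5 * t ^ 2 - 2 * k))
    rw [neg_div] at this
    linarith
  · have hden : 0 < 2 * (k : ℝ) * (2 * k + 1) := by positivity
    have hden' : 4 / 9 * (n : ℝ) ^ 2 ≤ 2 * (k : ℝ) * (2 * k + 1) := by nlinarith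
    have hid : (-2 * q * n * t - 5 * t ^ 2 - 2 * k) + 5 * q / 2 * t / n * (2 * (k : ℝ) * (2 * k + 1))
        = 15 * t ^ 2 - 2 * k + 10 * (q * v) * t ^ 2 + 5 * (q * v) * k := by
      rw [mul_div_assoc, ← hv, hkd, htv]
      linear_combination (4 * (n : ℝ) ^ 2 * v ^ 2 + 2 * q * v * (n : ℝ) ^ 2 / 5) * h5
    have hnum : (-2 * q * n * t - 5 * t ^ 2 - 2 * k)
          + 5 * q / 2 * t / n * (2 * (k : ℝ) * (2 * k + 1)) ≤
        (41 * J ^ 2 + 9) / n * (2 * (k : ℝ) * (2 * k + 1)) := by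
      rw [hid]
      have : (41 * J ^ 2 + 9) / n * (4 / 9 * (n : ℝ) ^ 2) ≤
          (41 * J ^ 2 + 9) / n * (2 * (k : ℝ) * (2 * k + 1)) := by gcongr
      have e : (41 * J ^ 2 + 9) / n * (4 / 9 * (n : ℝ) ^ 2) = 4 / 9 * (41 * J ^ 2 + 9) * n := by
        field_simp
      linarith
    have := (div_le_iff₀ hden).2 (by linarith :
      (-2 * q * n * t - 5 * t ^ 2 - 2 * k) ≤
      ((41 * J ^ 2 + 9) / n - 5 * q / 2 * t / n) * (2 * (k : ℝ) * (2 * k + 1)))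
    linarith

/-- Telescoping: at most `2J√n` steps, each with error `O(1/n)`. The discrete square contributes an
extra `(5√5/4)/n ≤ 3/n` per step, turning 9 into 12. -/
theorem log_A_sub_log_A_le {n k l : ℕ} {J : ℝ} (hn : 3 ≤ n) (_hJ0 : 0 ≤ J)
    (hJn : J * √n ≤ n / 10) (hkl : k ≤ l)
    (hk : |deviation n k| ≤ J * √n) (hl : |deviation n l| ≤ J * √n) :
    |Real.log (A n l) + 5 * √5 / 4 * deviation n l ^ 2 / n -
      (Real.log (A n k) + 5 * √5 / 4 * deviation n k ^ 2 / n)| ≤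
      2 * J * (41 * J ^ 2 + 12) / √n := by
  have hn0 : (0 : ℝ) < n := by have : (3 : ℝ) ≤ n := by exact_mod_cast hn
                               linarith
  have hsn : 0 < √(n : ℝ) := Real.sqrt_pos.2 hn0
  have hsq : √(n : ℝ) * √n = n := Real.mul_self_sqrt hn0.le
  have step : ∀ i, k ≤ i → i < l →
      |Real.log (A n (i + 1)) + 5 * √5 / 4 * deviation n (i + 1) ^ 2 / n -
      (Real.log (A n i) + 5 * √5 / 4 * deviation n i ^ 2 / n)| ≤ (41 * J ^ 2 + 12) / n := by
    intro i hki hil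
    have hi : |deviation n i| ≤ J * √n := by
      have h1 : (k : ℝ) ≤ i := by exact_mod_cast hki
      have h2 : (i : ℝ) ≤ l := by exact_mod_cast hil.le
      rw [abs_le] at hk hl ⊢
      simp only [deviation] at *
      constructor <;> linarith
    have h1 := abs_log_A_succ_sub_add_le (J := J) hn (hi.trans hJn) (by
      rw [← sq_abs, ← hsq]
      calc |deviation n i| ^ 2 ≤ (J * √n) ^ 2 := by gcongr
        _ = _ := by ring)
    rw [deviation_succ]
    have e : Real.log (A n (i + 1)) + 5 * √5 / 4 * (deviation n i + 1) ^ 2 / n -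
      (Real.log (A n i) + 5 * √5 / 4 * deviation n i ^ 2 / n) =
      (Real.log (A n (i + 1)) - Real.log (A n i) + 5 * √5 / 2 * deviation n i / n) +
        5 * √5 / 4 / n := by ring
    rw [e]
    refine (abs_add_le _ _).trans ?_
    have h2 : |5 * √5 / 4 / (n : ℝ)| ≤ 3 / n := by
      rw [abs_of_pos (by positivity)]
      gcongr
      linarith [sqrt_five_lt]
    refine (add_le_add h1 h2).trans (le_of_eq ?_)
    ring
  have hlen : (l - k : ℝ) ≤ 2 * J * √n := by
    rw [abs_le] at hk hl
    simp only [deviation] at hk hl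
    linarith
  have hbound : (l - k : ℝ) * ((41 * J ^ 2 + 12) / n) ≤ 2 * J * (41 * J ^ 2 + 12) / √n := by
    calc (l - k : ℝ) * ((41 * J ^ 2 + 12) / n) ≤ 2 * J * √n * ((41 * J ^ 2 + 12) / n) := by gcongr
      _ = 2 * J * (41 * J ^ 2 + 12) / √n := by
        rw [mul_div_assoc', div_eq_div_iff hn0.ne' hsn.ne']
        linear_combination (2 * J * (41 * J ^ 2 + 12)) * hsq
  have hup := sub_le_mul_of_forall_step
    (g := fun i => Real.log (A n i) + 5 * √5 / 4 * deviation n i ^ 2 / n) hkl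
    fun i h1 h2 => (abs_le.1 (step i h1 h2)).2
  have hlo := sub_le_mul_of_forall_step
    (δ := (41 * J ^ 2 + 12) / n)
    (g := fun i => -(Real.log (A n i) + 5 * √5 / 4 * deviation n i ^ 2 / n)) hkl
    fun i h1 h2 => by linarith [(abs_le.1 (step i h1 h2)).1]
  rw [abs_le]
  constructor <;> linarith

theorem eventually_const_le_sqrt (C : ℝ) : ∀ᶠ n : ℕ in atTop, C ≤ √(n : ℝ) :=
  (Real.tendsto_sqrt_atTop.comp tendsto_natCast_atTop_atTop).eventually_ge_atTop C

theorem tendsto_const_div_sqrt (C : ℝ) : Tendsto (fun n : ℕ => C / √(n : ℝ)) atTop (𝓝 0) :=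
  (Real.tendsto_sqrt_atTop.comp tendsto_natCast_atTop_atTop).const_div_atTop C

theorem eventually_abs_log_A_sub_log_A_center_le (J : ℝ) {ε : ℝ} (hε : 0 < ε) :
    ∀ᶠ n : ℕ in atTop, ∀ k : ℕ, |deviation n k| ≤ J * √n → 1 ≤ k ∧ k ≤ n ∧
      |Real.log (A n k) - Real.log (A n (center n)) +
        5 * √5 / 4 * (deviation n k / √n) ^ 2| ≤ ε := by
  -- `L ≥ 1` puts the centre, whose deviation is at most 1, inside the window.
  obtain ⟨L, hL1, hJL⟩ : ∃ L : ℝ, 1 ≤ L ∧ J ≤ L := ⟨max 1 J, le_max_left _ _, le_max_right _ _⟩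
  have hsmall : Tendsto (fun n : ℕ => 2 * L * (41 * L ^ 2 + 12) / √(n : ℝ) +
      3 / √(n : ℝ)) atTop (𝓝 0) := by
    simpa using (tendsto_const_div_sqrt _).add (tendsto_const_div_sqrt 3)
  filter_upwards [eventually_ge_atTop 3, eventually_const_le_sqrt (10 * L),
    hsmall.eventually_le_const hε] with n hn hnL hnε k hk
  have hn1 : (1 : ℝ) ≤ n := by exact_mod_cast (by omega : 1 ≤ n)
  have hn0 : (0 : ℝ) < n := by linarith
  have hsn1 : 1 ≤ √(n : ℝ) := by linarith
  have hsn : 0 < √(n : ℝ) := by linarith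
  have hsq : √(n : ℝ) * √n = n := Real.mul_self_sqrt hn0.le
  have hLn : L * √n ≤ n / 10 := by nlinarith
  have hkL : |deviation n k| ≤ L * √n := hk.trans (by gcongr)
  have hc0 := deviation_center_nonneg n
  have hc1 := deviation_center_le_one n
  have hcL : |deviation n (center n)| ≤ L * √n := by
    rw [abs_of_nonneg hc0]; nlinarith
  obtain ⟨-, -, hk1, hk2⟩ := bounds_of_abs_deviation_le hn (hkL.trans hLn)
  refine ⟨hk1, hk2.le, ?_⟩
  have hmain : |Real.log (A n k) + 5 * √5 / 4 * deviation n k ^ 2 / n -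
      (Real.log (A n (center n)) + 5 * √5 / 4 * deviation n (center n) ^ 2 / n)| ≤
      2 * L * (41 * L ^ 2 + 12) / √n := by
    rcases le_total k (center n) with h | h
    · rw [abs_sub_comm]
      exact log_A_sub_log_A_le hn (by linarith) hLn h hkL hcL
    · exact log_A_sub_log_A_le hn (by linarith) hLn h hcL hkL
  have hc : |5 * √5 / 4 * deviation n (center n) ^ 2 / n| ≤ 3 / √n := by
    rw [abs_of_nonneg (by positivity)]
    have h1 : deviation n (center n) ^ 2 ≤ 1 := by nlinarith
    calc 5 * √5 / 4 * deviation n (center n) ^ 2 / n ≤ 3 / n := by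
          gcongr; nlinarith [sqrt_five_lt, lt_sqrt_five]
      _ ≤ 3 / √n := by gcongr; nlinarith
  have e : Real.log (A n k) - Real.log (A n (center n)) + 5 * √5 / 4 * (deviation n k / √n) ^ 2 =
      (Real.log (A n k) + 5 * √5 / 4 * deviation n k ^ 2 / n -
      (Real.log (A n (center n)) + 5 * √5 / 4 * deviation n (center n) ^ 2 / n)) +
        5 * √5 / 4 * deviation n (center n) ^ 2 / n := by
    rw [div_pow, Real.sq_sqrt hn0.le]; ring
  rw [e]
  exact (abs_add_le _ _).trans ((add_le_add hmain hc).trans hnε)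

/-! ### A Gaussian bound on the whole range -/

/-- The slope `1/2` is far below the true `5√5/2`, but it survives up to `k < n`, using only
`2k(2k+1) ≤ 6n²`. -/
theorem log_A_succ_sub_le_of_nonneg {n k : ℕ} (hk : 1 ≤ k) (hkn : k < n)
    (h : 0 ≤ deviation n k) :
    Real.log (A n (k + 1)) - Real.log (A n k) ≤ -(deviation n k / (2 * n)) := by
  refine (log_A_succ_sub_le hk hkn).trans ?_
  have hk' : (1 : ℝ) ≤ k := by exact_mod_cast hk
  have hn' : (k : ℝ) < n := by exact_mod_cast hkn
  rw [sq_sub_five_mul_sq, div_le_iff₀ (by positivity)]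
  set t := deviation n k
  have h1 : t / (2 * n) * (2 * k * (2 * k + 1)) ≤ t / (2 * n) * (6 * (n : ℝ) ^ 2) :=
    mul_le_mul_of_nonneg_left (by nlinarith) (by positivity)
  have hn0 : (0 : ℝ) < n := by linarith
  have h2 : t / (2 * n) * (6 * (n : ℝ) ^ 2) = 3 * n * t := by field_simp; ring
  have h3 : 0 ≤ n * t := by positivity
  nlinarith [lt_sqrt_five, sq_nonneg t]

/-- As `k ≥ 0`, the quadratic term costs at most half of the linear one. The loss `2/n` pays for the
term `-2k`. -/
theorem le_log_A_succ_sub_of_nonpos {n k : ℕ} (hk : 1 ≤ k) (hkn : k < n)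
    (h : deviation n k ≤ 0) :
    -(deviation n k / (2 * n)) - 2 / n ≤ Real.log (A n (k + 1)) - Real.log (A n k) := by
  refine le_trans ?_ (le_log_A_succ_sub hk hkn)
  have hk' : (1 : ℝ) ≤ k := by exact_mod_cast hk
  have hn' : (k : ℝ) < n := by exact_mod_cast hkn
  have hn0 : (0 : ℝ) < n := by linarith
  have hden : 0 < (n : ℝ) ^ 2 - (k : ℝ) ^ 2 := by nlinarith
  have hkt : (k : ℝ) = √5 / 5 * n + deviation n k := by simp [deviation]
  have hkc : (k : ℝ) ≤ 0.45 * n := by nlinarith [sqrt_five_lt]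
  rw [sq_sub_five_mul_sq, le_div_iff₀ hden]
  obtain ⟨s, hs⟩ : ∃ s, deviation n k = -s := ⟨_, (neg_neg _).symm⟩
  rw [hs] at h hkt ⊢
  have hs0 : 0 ≤ s := by linarith
  have hsn : 5 * s ≤ √5 * n := by linarith
  have h1 : s / (2 * n) * ((n : ℝ) ^ 2 - (k : ℝ) ^ 2) ≤ s / (2 * n) * (n : ℝ) ^ 2 := by
    gcongr
    nlinarith
  have h2 : s / (2 * n) * (n : ℝ) ^ 2 = s * n / 2 := by field_simp
  -- `0.79 < 1 - 0.45²`.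
  have h3 : 2 / n * (0.79 * (n : ℝ) ^ 2) ≤ 2 / n * ((n : ℝ) ^ 2 - (k : ℝ) ^ 2) := by
    gcongr
    nlinarith
  have h4 : 2 / n * (0.79 * (n : ℝ) ^ 2) = 1.58 * n := by field_simp; norm_num
  have h5 : 5 * s ^ 2 ≤ √5 * (n * s) := by nlinarith
  have h6 : 0 ≤ n * s := by positivity
  have h7 : 2 * (n * s) ≤ √5 * (n * s) := by
    gcongr; linarith [lt_sqrt_five]
  have e : (-(-s / (2 * n)) - 2 / n) * ((n : ℝ) ^ 2 - (k : ℝ) ^ 2) =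
    s / (2 * n) * ((n : ℝ) ^ 2 - (k : ℝ) ^ 2) - 2 / n * ((n : ℝ) ^ 2 - (k : ℝ) ^ 2) := by ring
  rw [e]
  nlinarith

/-- At most `n` steps lose at most `2/n` each, and the centre's own quadratic term is at most 1:
hence `exp 3`. -/
theorem A_le_exp_mul {n k : ℕ} (hn : 1 ≤ n) (hk : 1 ≤ k) (hkn : k ≤ n) :
    (A n k : ℝ) / A n (center n) ≤ Real.exp 3 * Real.exp (-(deviation n k ^ 2 / (4 * n))) := by
  have hn1 : (1 : ℝ) ≤ n := by exact_mod_cast hn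
  have hn0 : (0 : ℝ) < n := by linarith
  have hA : (0 : ℝ) < A n k := by exact_mod_cast A_pos hk hkn
  have hB : (0 : ℝ) < A n (center n) := by exact_mod_cast A_pos (one_le_center hn) (center_le n)
  have hc0 := deviation_center_nonneg n
  have hc1 := deviation_center_le_one n
  have hsq : ∀ i, deviation n (i + 1) ^ 2 / (4 * n) - deviation n i ^ 2 / (4 * n) =
      deviation n i / (2 * n) + 1 / (4 * n) := by
    intro i; rw [deviation_succ]; field_simp; ring
  have hinv : 1 / (4 * (n : ℝ)) ≤ 2 / n := by
    rw [div_le_div_iff₀ (by positivity) hn0]; linarith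
  have key : (Real.log (A n k) + deviation n k ^ 2 / (4 * n)) -
      (Real.log (A n (center n)) + deviation n (center n) ^ 2 / (4 * n)) ≤ n * (2 / n) := by
    rcases le_total (center n) k with h | h
    · refine (sub_le_mul_of_forall_step (δ := 2 / n)
        (g := fun i => Real.log (A n i) + deviation n i ^ 2 / (4 * n)) h ?_).trans ?_
      · intro i h1 h2
        have h3 : (center n : ℝ) ≤ i := by exact_mod_cast h1
        have := log_A_succ_sub_le_of_nonneg ((one_le_center hn).trans h1) (by omega : i < n)
          (by simp only [deviation] at hc0 ⊢; linarith)
        have := hsq i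
        linarith
      · gcongr
        have h1 : (k : ℝ) ≤ n := by exact_mod_cast hkn
        have h2 : (0 : ℝ) ≤ center n := by positivity
        linarith
    · have := sub_le_mul_of_forall_step (δ := 2 / n)
        (g := fun i => -(Real.log (A n i) + deviation n i ^ 2 / (4 * n))) h (by
          intro i h1 h2
          have h3 : (i : ℝ) + 1 ≤ center n := by exact_mod_cast h2
          have := le_log_A_succ_sub_of_nonpos (hk.trans h1) (h2.trans_le (center_le n))
            (by simp only [deviation] at hc1 ⊢; linarith)
          have := hsq i
          have : 0 ≤ 1 / (4 * (n : ℝ)) := by positivity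
          linarith)
      have h4 : ((center n : ℝ) - k) * (2 / n) ≤ n * (2 / n) := by
        gcongr
        have h1 : (center n : ℝ) ≤ n := by exact_mod_cast center_le n
        have h2 : (0 : ℝ) ≤ k := by positivity
        linarith
      linarith
  have h2 : (n : ℝ) * (2 / n) = 2 := by field_simp
  have h3 : deviation n (center n) ^ 2 / (4 * n) ≤ 1 := by
    rw [div_le_one (by positivity)]; nlinarith
  rw [← Real.exp_add, ← Real.log_le_iff_le_exp (by positivity), Real.log_div hA.ne' hB.ne']
  linarith

/-! ### Scaled moments as integrals of step functions -/

/-- The largest natural number whose deviation is at most `y * √n` (or `0`). -/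
noncomputable def unscale (n : ℕ) (y : ℝ) : ℕ := ⌊√5 / 5 * n + y * √n⌋₊

/-- The summand of the `p`-th scaled moment belonging to the integer `k`. -/
noncomputable def momentTerm (p n k : ℕ) : ℝ :=
  (A n k : ℝ) / A n (center n) * (deviation n k / √n) ^ p

/-- The `p`-th moment about `n / √5`, scaled by the standard order of magnitude and by the
coefficient at the centre. -/
noncomputable def scaledMoment (p n : ℕ) : ℝ :=
  (∑ k ∈ range (n + 1), momentTerm p n k) / √n

theorem momentTerm_zero_right {p n : ℕ} (hn : 1 ≤ n) : momentTerm p n 0 = 0 := by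
  simp [momentTerm, A_zero_right hn]

theorem momentTerm_eq_zero_of_lt {p n k : ℕ} (h : n < k) : momentTerm p n k = 0 := by
  simp [momentTerm, A_eq_zero_of_lt h]

theorem momentTerm_unscale_eq_sum {p n : ℕ} (hn : 1 ≤ n) :
    (fun y => momentTerm p n (unscale n y)) = fun y => ∑ k ∈ range (n + 1),
      (Set.Ico (deviation n k / √n) (deviation n k / √n + 1 / √n)).indicator
        (fun _ => momentTerm p n k) y := by
  ext y
  have hsn : 0 < √(n : ℝ) := Real.sqrt_pos.2 (by exact_mod_cast hn)
  have hterm : ∀ k ∈ range (n + 1),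
      (Set.Ico (deviation n k / √n) (deviation n k / √n + 1 / √n)).indicator
        (fun _ => momentTerm p n k) y = if unscale n y = k then momentTerm p n k else 0 := by
    intro k _
    -- The natural floor sends a whole half-line to 0, not just an interval of length `1/√n`; this
    -- is harmless because `A n 0 = 0`.
    rcases Nat.eq_zero_or_pos k with rfl | hk
    · simp [momentTerm_zero_right hn]
    · rw [Set.indicator_apply]
      congr 1
      rw [unscale, Nat.floor_eq_iff' hk.ne', Set.mem_Ico, div_le_iff₀ hsn, ← add_div,
        lt_div_iff₀ hsn, eq_iff_iff, deviation]
      constructor <;> rintro ⟨h1, h2⟩ <;> constructor <;> linarith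
  rw [sum_congr rfl hterm, sum_ite_eq]
  split_ifs with h
  · rfl
  · exact momentTerm_eq_zero_of_lt (by simpa using h)

theorem integral_momentTerm_unscale {p n : ℕ} (hn : 1 ≤ n) :
    ∫ y, momentTerm p n (unscale n y) = scaledMoment p n := by
  rw [momentTerm_unscale_eq_sum hn, integral_finsetSum, scaledMoment, sum_div]
  · refine sum_congr rfl fun k _ => ?_
    rw [integral_indicator measurableSet_Ico, setIntegral_const, measureReal_def, Real.volume_Ico,
      add_sub_cancel_left, ENNReal.toReal_ofReal (by positivity), smul_eq_mul]
    ring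
  · intro k _
    exact (integrable_indicator_iff measurableSet_Ico).2 (integrableOn_const (by simp))

theorem measurable_momentTerm_unscale (p n : ℕ) :
    Measurable fun y => momentTerm p n (unscale n y) := by
  refine (measurable_from_nat (f := momentTerm p n)).comp ?_
  unfold unscale
  fun_prop

theorem abs_deviation_sub_le {n k : ℕ} {z : ℝ} (h : |(k : ℝ) - (√5 / 5 * n + z * √n)| ≤ 1)
    (hn : 1 ≤ n) : |deviation n k / √n - z| ≤ 1 / √n := by
  have hsn : 0 < √(n : ℝ) := Real.sqrt_pos.2 (by exact_mod_cast hn)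
  rw [show deviation n k / √n - z = ((k : ℝ) - (√5 / 5 * n + z * √n)) / √n by
    rw [deviation]; field_simp; ring, abs_div, abs_of_pos hsn]
  gcongr

theorem abs_floor_sub_le {z : ℝ} (hz : 0 ≤ z) : |(⌊z⌋₊ : ℝ) - z| ≤ 1 := by
  have h1 := Nat.floor_le hz
  have h2 := Nat.lt_floor_add_one z
  rw [abs_le]
  constructor <;> linarith

/-- The dominating function. Half of the exponent `t²/4` absorbs `|t|^p`; the other half passes from
`t` to `y` because `|t - y| ≤ 1`. -/
theorem abs_momentTerm_unscale_le {p n : ℕ} (hn : 1 ≤ n) (hp : p ≤ 2) (y : ℝ) :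
    |momentTerm p n (unscale n y)| ≤ 8 * Real.exp 4 * Real.exp (-(1 / 16) * y ^ 2) := by
  set k := unscale n y with hk
  rcases Nat.eq_zero_or_pos k with h0 | h0
  · rw [h0, momentTerm_zero_right hn, abs_zero]; positivity
  rcases lt_or_ge n k with h | h
  · rw [momentTerm_eq_zero_of_lt h, abs_zero]; positivity
  have hn1 : (1 : ℝ) ≤ n := by exact_mod_cast hn
  have hn0 : (0 : ℝ) < n := by linarith
  have hsn : 0 < √(n : ℝ) := Real.sqrt_pos.2 hn0
  have hz : 0 ≤ √5 / 5 * n + y * √n := by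
    by_contra hneg
    rw [hk, unscale, Nat.floor_of_nonpos (not_le.1 hneg).le] at h0
    exact lt_irrefl _ h0
  have hdev := abs_deviation_sub_le (abs_floor_sub_le hz) hn
  change |deviation n k / √n - y| ≤ 1 / √n at hdev
  have hle1 : 1 / √(n : ℝ) ≤ 1 := by
    rw [div_le_one hsn]; exact Real.one_le_sqrt.2 hn1
  have hA := A_le_exp_mul hn h0 h
  rw [show -(deviation n k ^ 2 / (4 * n)) = -(1 / 4) * (deviation n k / √n) ^ 2 by
    rw [div_pow, Real.sq_sqrt hn0.le]; field_simp] at hA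
  set t := deviation n k / √n with ht
  obtain ⟨hd1, hd2⟩ := abs_le.1 (hdev.trans hle1)
  have hy : y ^ 2 ≤ 2 * t ^ 2 + 2 := by nlinarith [sq_nonneg (t + (t - y))]
  have hpow : |t| ^ p ≤ 8 * Real.exp (t ^ 2 / 8) := by
    have h1 : t ^ 2 / 8 + 1 ≤ Real.exp (t ^ 2 / 8) := Real.add_one_le_exp _
    have h2 : |t| ^ p ≤ 1 + t ^ 2 := by
      interval_cases p
      · nlinarith [sq_nonneg t]
      · nlinarith [sq_abs t, sq_nonneg (|t| - 1)]
      · rw [sq_abs]; linarith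
    linarith
  rw [momentTerm, ← ht, abs_mul, abs_pow, abs_of_nonneg (by positivity)]
  calc (A n k : ℝ) / A n (center n) * |t| ^ p
      ≤ (Real.exp 3 * Real.exp (-(1 / 4) * t ^ 2)) * (8 * Real.exp (t ^ 2 / 8)) := by gcongr
    _ = 8 * Real.exp (3 + -(1 / 4) * t ^ 2 + t ^ 2 / 8) := by
        rw [Real.exp_add, Real.exp_add]; ring
    _ ≤ 8 * Real.exp (4 + -(1 / 16) * y ^ 2) := by
        gcongr ?_ * Real.exp ?_
        linarith
    _ = _ := by rw [Real.exp_add]; ring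

theorem tendsto_deviation_unscale (y : ℝ) :
    Tendsto (fun n => deviation n (unscale n y) / √n) atTop (𝓝 y) := by
  have h : Tendsto (fun n => deviation n (unscale n y) / √n - y) atTop (𝓝 0) := by
    refine squeeze_zero_norm' ?_ (tendsto_const_div_sqrt 1)
    -- `√n ≥ 3|y|` keeps the floored quantity nonnegative, as `√5/5 > 1/3`.
    filter_upwards [eventually_ge_atTop 1, eventually_const_le_sqrt (3 * |y|)] with n hn hny
    refine abs_deviation_sub_le (abs_floor_sub_le ?_) hn
    have hsq : √(n : ℝ) * √n = n := Real.mul_self_sqrt (by positivity)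
    have hsn : 0 ≤ √(n : ℝ) := by positivity
    have h1 : -|y| * √n ≤ y * √n := by gcongr; exact neg_abs_le y
    have h2 : 3 * |y| * √n ≤ n := by rw [← hsq, Real.sqrt_mul_self hsn]; gcongr
    nlinarith [lt_sqrt_five, abs_nonneg y]
  simpa using h.add_const y

theorem tendsto_momentTerm_unscale (p : ℕ) (y : ℝ) :
    Tendsto (fun n => momentTerm p n (unscale n y)) atTop
      (𝓝 (Real.exp (-(5 * √5 / 4) * y ^ 2) * y ^ p)) := by
  have hdev := tendsto_deviation_unscale y
  have hwin : ∀ᶠ n : ℕ in atTop, |deviation n (unscale n y)| ≤ (|y| + 1) * √n := by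
    filter_upwards [hdev.abs.eventually_le_const (lt_add_one |y|), eventually_ge_atTop 1]
      with n h hn
    have hsn : 0 < √(n : ℝ) := Real.sqrt_pos.2 (by exact_mod_cast hn)
    rwa [abs_div, abs_of_pos hsn, div_le_iff₀ hsn] at h
  have hlog : Tendsto (fun n => Real.log (A n (unscale n y)) - Real.log (A n (center n)) +
      5 * √5 / 4 * (deviation n (unscale n y) / √n) ^ 2) atTop (𝓝 0) := by
    rw [Metric.tendsto_nhds]
    intro ε hε
    filter_upwards [eventually_abs_log_A_sub_log_A_center_le (|y| + 1) (half_pos hε), hwin]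
      with n h1 h2
    rw [Real.dist_eq, sub_zero]
    exact (h1 _ h2).2.2.trans_lt (half_lt_self hε)
  have hlim := ((hlog.sub ((hdev.pow 2).const_mul (5 * √5 / 4))).rexp).mul (hdev.pow p)
  rw [zero_sub, ← neg_mul] at hlim
  refine hlim.congr' ?_
  filter_upwards [eventually_abs_log_A_sub_log_A_center_le (|y| + 1) one_pos, hwin,
    eventually_ge_atTop 1] with n h1 h2 hn
  obtain ⟨hk1, hk2, -⟩ := h1 _ h2
  have hA : (0 : ℝ) < A n (unscale n y) := by exact_mod_cast A_pos hk1 hk2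
  have hB : (0 : ℝ) < A n (center n) := by exact_mod_cast A_pos (one_le_center hn) (center_le n)
  rw [momentTerm, add_sub_cancel_right, Real.exp_sub, Real.exp_log hA, Real.exp_log hB]

theorem tendsto_scaledMoment {p : ℕ} (hp : p ≤ 2) :
    Tendsto (scaledMoment p) atTop
      (𝓝 (∫ y : ℝ, Real.exp (-(5 * √5 / 4) * y ^ 2) * y ^ p)) := by
  have := tendsto_integral_filter_of_dominated_convergence (μ := volume)
    (F := fun n y => momentTerm p n (unscale n y))
    (f := fun y : ℝ => Real.exp (-(5 * √5 / 4) * y ^ 2) * y ^ p) (l := atTop)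
    (fun y => 8 * Real.exp 4 * Real.exp (-(1 / 16) * y ^ 2))
    (Eventually.of_forall fun n => (measurable_momentTerm_unscale p n).aestronglyMeasurable)
    ((eventually_ge_atTop 1).mono fun n hn =>
      Eventually.of_forall fun y => abs_momentTerm_unscale_le hn hp y)
    ((integrable_exp_neg_mul_sq (by norm_num)).const_mul _)
    (Eventually.of_forall fun y => tendsto_momentTerm_unscale p y)
  refine this.congr' ?_
  filter_upwards [eventually_ge_atTop 1] with n hn
  exact integral_momentTerm_unscale hn

/-! ### Gaussian moments and the limits of the scaled moments -/

theorem integral_exp_neg_mul_sq_mul_self (b : ℝ) :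
    ∫ y : ℝ, Real.exp (-b * y ^ 2) * y ^ 1 = 0 := by
  have h := integral_neg_eq_self (fun y : ℝ => Real.exp (-b * y ^ 2) * y ^ 1) volume
  simp only [neg_sq, pow_one, mul_neg, integral_neg] at h
  simp only [pow_one]
  linarith

/-- This is the variance of the centred normal law with `v = 1/(2b)`, up to normalization. -/
theorem integral_exp_neg_mul_sq_mul_sq {b : ℝ} (hb : 0 < b) :
    ∫ y : ℝ, Real.exp (-b * y ^ 2) * y ^ 2 = √(Real.pi / b) / (2 * b) := by
  have hv : (0 : ℝ) < 1 / (2 * b) := by positivity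
  obtain ⟨v, hv'⟩ : ∃ v : NNReal, (v : ℝ) = 1 / (2 * b) := ⟨⟨_, hv.le⟩, rfl⟩
  have hv0 : v ≠ 0 := by
    rintro rfl
    rw [NNReal.coe_zero] at hv'
    linarith
  have h := ProbabilityTheory.variance_id_gaussianReal (μ := 0) (v := v)
  rw [ProbabilityTheory.variance_eq_integral aemeasurable_id] at h
  simp only [id, ProbabilityTheory.integral_id_gaussianReal, sub_zero] at h
  rw [ProbabilityTheory.integral_gaussianReal_eq_integral_smul hv0] at h
  simp only [ProbabilityTheory.gaussianPDFReal, hv', smul_eq_mul, sub_zero] at h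
  have e : ∀ y : ℝ, (√(2 * Real.pi * (1 / (2 * b))))⁻¹ * Real.exp (-y ^ 2 / (2 * (1 / (2 * b)))) *
      y ^ 2 = (√(Real.pi / b))⁻¹ * (Real.exp (-b * y ^ 2) * y ^ 2) := by
    intro y
    rw [show 2 * Real.pi * (1 / (2 * b)) = Real.pi / b by field_simp,
      show -y ^ 2 / (2 * (1 / (2 * b))) = -b * y ^ 2 by field_simp, mul_assoc]
  simp only [e, integral_const_mul] at h
  have hs : 0 < √(Real.pi / b) := Real.sqrt_pos.2 (by positivity)
  rw [inv_mul_eq_iff_eq_mul₀ hs.ne'] at h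
  rw [h]
  ring

theorem tendsto_scaledMoment_zero :
    Tendsto (scaledMoment 0) atTop (𝓝 √(Real.pi / (5 * √5 / 4))) := by
  have h := tendsto_scaledMoment (p := 0) (by norm_num)
  simpa only [pow_zero, mul_one, integral_gaussian] using h

theorem tendsto_scaledMoment_one : Tendsto (scaledMoment 1) atTop (𝓝 0) := by
  have h := tendsto_scaledMoment (p := 1) (by norm_num)
  rwa [integral_exp_neg_mul_sq_mul_self] at h

theorem tendsto_scaledMoment_two :
    Tendsto (scaledMoment 2) atTop
      (𝓝 (√(Real.pi / (5 * √5 / 4)) / (2 * (5 * √5 / 4)))) := by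
  have h := tendsto_scaledMoment (p := 2) le_rfl
  rwa [integral_exp_neg_mul_sq_mul_sq (by positivity)] at h

/-! ### Mean, variance and Fibonacci numbers through scaled moments -/

theorem A_center_pos {n : ℕ} (hn : 1 ≤ n) : (0 : ℝ) < A n (center n) := by
  exact_mod_cast A_pos (one_le_center hn) (center_le n)

theorem fib_pos_of_one_le {n : ℕ} (hn : 1 ≤ n) : (0 : ℝ) < Nat.fib (2 * n) := by
  exact_mod_cast Nat.fib_pos.2 (by omega)

theorem prob_eq {n : ℕ} (hn : 1 ≤ n) (k : ℕ) : prob n k = A n k / Nat.fib (2 * n) := by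
  rw [prob, ← sum_A hn]
  push_cast
  rfl

theorem sum_prob {n : ℕ} (hn : 1 ≤ n) : ∑ k ∈ range (n + 1), prob n k = 1 := by
  simp only [prob_eq hn, ← sum_div]
  rw [div_eq_one_iff_eq (fib_pos_of_one_le hn).ne', ← sum_A hn]
  push_cast
  rfl

theorem sum_deviation_pow_mul_prob {n : ℕ} (hn : 1 ≤ n) (p : ℕ) :
    ∑ k ∈ range (n + 1), (deviation n k / √n) ^ p * prob n k =
      √n * A n (center n) * scaledMoment p n / Nat.fib (2 * n) := by
  have hsn : √(n : ℝ) ≠ 0 := (Real.sqrt_pos.2 (by exact_mod_cast hn)).ne'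
  have hB := (A_center_pos hn).ne'
  rw [scaledMoment, show √(n : ℝ) * A n (center n) * ((∑ k ∈ range (n + 1), momentTerm p n k) / √n)
    = A n (center n) * ∑ k ∈ range (n + 1), momentTerm p n k by field_simp, mul_sum, sum_div]
  refine sum_congr rfl fun k _ => ?_
  rw [prob_eq hn, momentTerm, ← mul_assoc, mul_div_cancel₀ _ hB]
  ring

/-- The case `p = 0`, total mass 1, ties the central coefficient to `F_{2n}`. -/
theorem fib_eq {n : ℕ} (hn : 1 ≤ n) :
    (Nat.fib (2 * n) : ℝ) = √n * A n (center n) * scaledMoment 0 n := by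
  have h := sum_deviation_pow_mul_prob hn 0
  simp only [pow_zero, one_mul, sum_prob hn] at h
  rw [eq_div_iff (fib_pos_of_one_le hn).ne'] at h
  linarith

theorem scaledMoment_zero_pos {n : ℕ} (hn : 1 ≤ n) : 0 < scaledMoment 0 n := by
  have h := fib_pos_of_one_le hn
  rw [fib_eq hn] at h
  exact pos_of_mul_pos_right h (by positivity)

theorem sum_deviation_pow_mul_prob_eq_div {n : ℕ} (hn : 1 ≤ n) (p : ℕ) :
    ∑ k ∈ range (n + 1), (deviation n k / √n) ^ p * prob n k =
      scaledMoment p n / scaledMoment 0 n := by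
  have hsn : √(n : ℝ) ≠ 0 := (Real.sqrt_pos.2 (by exact_mod_cast hn)).ne'
  have hB := (A_center_pos hn).ne'
  have hS := (scaledMoment_zero_pos hn).ne'
  rw [sum_deviation_pow_mul_prob hn, fib_eq hn]
  field_simp

theorem mean_eq {n : ℕ} (hn : 1 ≤ n) :
    mean n = √5 / 5 * n + scaledMoment 1 n / scaledMoment 0 n * √n := by
  have hsn : √(n : ℝ) ≠ 0 := (Real.sqrt_pos.2 (by exact_mod_cast hn)).ne'
  rw [← sum_deviation_pow_mul_prob_eq_div hn, sum_mul,
    ← mul_one (√5 / 5 * (n : ℝ)), ← sum_prob hn, mul_sum, ← sum_add_distrib, mean]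
  refine sum_congr rfl fun k _ => ?_
  rw [deviation]
  field_simp
  ring

theorem variance_eq {n : ℕ} (hn : 1 ≤ n) :
    variance n = n * (scaledMoment 2 n / scaledMoment 0 n -
      (scaledMoment 1 n / scaledMoment 0 n) ^ 2) := by
  have hsn : √(n : ℝ) ≠ 0 := (Real.sqrt_pos.2 (by exact_mod_cast hn)).ne'
  have hsq : √(n : ℝ) ^ 2 = n := Real.sq_sqrt (by positivity)
  set m := scaledMoment 1 n / scaledMoment 0 n with hm
  have h1 := sum_deviation_pow_mul_prob_eq_div hn 1
  have h2 := sum_deviation_pow_mul_prob_eq_div hn 2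
  have h0 := sum_prob hn
  have hterm : ∀ k ∈ range (n + 1), ((k : ℝ) - mean n) ^ 2 * prob n k =
      n * ((deviation n k / √n) ^ 2 * prob n k) -
        2 * n * m * ((deviation n k / √n) ^ 1 * prob n k) + n * m ^ 2 * prob n k := by
    intro k _
    have hk : (k : ℝ) - mean n = √n * (deviation n k / √n - m) := by
      rw [mean_eq hn, ← hm, deviation]
      field_simp
      ring
    rw [hk, mul_pow, hsq]
    ring
  rw [variance, sum_congr rfl hterm, sum_add_distrib, sum_sub_distrib, ← mul_sum, ← mul_sum,
    ← mul_sum, h0, h1, h2, ← hm]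
  ring

theorem sigma_div_sqrt {n : ℕ} (hn : 1 ≤ n) :
    sigma n / √n = √(scaledMoment 2 n / scaledMoment 0 n -
      (scaledMoment 1 n / scaledMoment 0 n) ^ 2) := by
  have hsn : √(n : ℝ) ≠ 0 := (Real.sqrt_pos.2 (by exact_mod_cast hn)).ne'
  rw [sigma, variance_eq hn, Real.sqrt_mul (by positivity), mul_div_cancel_left₀ _ hsn]

theorem tendsto_mean :
    Tendsto (fun n : ℕ => (mean n - √5 / 5 * n) / √n) atTop (𝓝 0) := by
  have h := tendsto_scaledMoment_one.div tendsto_scaledMoment_zero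
    (Real.sqrt_pos.2 (by positivity)).ne'
  rw [zero_div] at h
  refine h.congr' ?_
  filter_upwards [eventually_ge_atTop 1] with n hn
  have hsn : √(n : ℝ) ≠ 0 := (Real.sqrt_pos.2 (by exact_mod_cast hn)).ne'
  rw [mean_eq hn, add_sub_cancel_left, mul_div_cancel_right₀ _ hsn, Pi.div_apply]

theorem tendsto_sigma :
    Tendsto (fun n : ℕ => sigma n / √n) atTop (𝓝 √(1 / (2 * (5 * √5 / 4)))) := by
  have hI : √(Real.pi / (5 * √5 / 4)) ≠ 0 := (Real.sqrt_pos.2 (by positivity)).ne'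
  have h := ((tendsto_scaledMoment_two.div tendsto_scaledMoment_zero hI).sub
    ((tendsto_scaledMoment_one.div tendsto_scaledMoment_zero hI).pow 2)).sqrt
  rw [zero_div, zero_pow two_ne_zero, sub_zero, div_right_comm, div_self hI] at h
  refine h.congr' ?_
  filter_upwards [eventually_ge_atTop 1] with n hn
  rw [sigma_div_sqrt hn]
  rfl

/-- With `b = 5√5/4`, the limit before taking logarithms is `√(2π) * √(1/(2b)) / √(π/b) = 1`. -/
theorem tendsto_log_normalization :
    Tendsto (fun n : ℕ => Real.log (√(2 * Real.pi) * (sigma n / √n) / scaledMoment 0 n)) atTop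
      (𝓝 0) := by
  have hI : √(Real.pi / (5 * √5 / 4)) ≠ 0 := (Real.sqrt_pos.2 (by positivity)).ne'
  have h := (tendsto_sigma.const_mul √(2 * Real.pi)).div tendsto_scaledMoment_zero hI
  have e : √(2 * Real.pi) * √(1 / (2 * (5 * √5 / 4))) / √(Real.pi / (5 * √5 / 4)) = 1 := by
    rw [← Real.sqrt_mul (by positivity), div_eq_one_iff_eq hI]
    congr 1
    field_simp
  rw [e] at h
  simpa using h.log one_ne_zero

theorem eventually_sigma_pos : ∀ᶠ n : ℕ in atTop, 0 < sigma n := by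
  filter_upwards [tendsto_sigma.eventually_const_lt (Real.sqrt_pos.2 (by positivity)),
    eventually_ge_atTop 1] with n h hn
  have hsn : 0 < √(n : ℝ) := Real.sqrt_pos.2 (by exact_mod_cast hn)
  exact (div_pos_iff_of_pos_right hsn).1 h

/-! ### Uniform comparison with the normal density -/

/-- Allowing an error of 1 in `k` treats exact integers and floors at once. -/
theorem eventually_abs_scaled_sub_le (M : ℝ) {ε : ℝ} (hε : 0 < ε) :
    ∀ᶠ n : ℕ in atTop, ∀ (k : ℕ) (x : ℝ), |x| ≤ M → |(k : ℝ) - (mean n + x * sigma n)| ≤ 1 →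
      |deviation n k / √n - x * √(1 / (2 * (5 * √5 / 4)))| ≤ ε := by
  set s := √(1 / (2 * (5 * √5 / 4))) with hs
  have hlim : Tendsto (fun n : ℕ => 1 / √(n : ℝ) + |(mean n - √5 / 5 * n) / √n| +
      M * |sigma n / √n - s|) atTop (𝓝 0) := by
    have h1 := tendsto_mean.abs
    have h2 := ((tendsto_sigma.sub_const s).abs).const_mul M
    rw [sub_self, abs_zero, mul_zero] at h2
    rw [abs_zero] at h1
    simpa only [add_zero] using ((tendsto_const_div_sqrt 1).add h1).add h2
  filter_upwards [hlim.eventually_le_const hε, eventually_ge_atTop 1] with n hle hn k x hx hk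
  have hsn : 0 < √(n : ℝ) := Real.sqrt_pos.2 (by exact_mod_cast hn)
  have e : deviation n k / √n - x * s = ((k : ℝ) - (mean n + x * sigma n)) / √n +
      (mean n - √5 / 5 * n) / √n + x * (sigma n / √n - s) := by
    rw [deviation]; field_simp; ring
  rw [e]
  refine (abs_add_three _ _ _).trans (le_trans ?_ hle)
  gcongr
  · rw [abs_div, abs_of_pos hsn]; gcongr
  · rw [abs_mul]; gcongr

theorem eventually_abs_ratio_sub_one_le (M : ℝ) {ε : ℝ} (hε : 0 < ε) :
    ∀ᶠ n : ℕ in atTop, ∀ (k : ℕ) (x : ℝ), |x| ≤ M → |(k : ℝ) - (mean n + x * sigma n)| ≤ 1 →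
      |(A n k : ℝ) / ((Nat.fib (2 * n) : ℝ) * (phi x / sigma n)) - 1| ≤ ε := by
  obtain ⟨L, hL1, hML⟩ : ∃ L : ℝ, 1 ≤ L ∧ M ≤ L := ⟨max 1 M, le_max_left _ _, le_max_right _ _⟩
  -- Chosen for `|exp u - 1| ≤ 2|u|`, valid for `|u| ≤ 1`; the exponent `u` will be a sum of three
  -- terms of size at most `η/3`.
  obtain ⟨η, hη0, hη1, hηε⟩ : ∃ η : ℝ, 0 < η ∧ η ≤ 1 ∧ 2 * η ≤ ε :=
    ⟨min 1 (ε / 2), lt_min one_pos (half_pos hε), min_le_left _ _, by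
      linarith [min_le_right 1 (ε / 2)]⟩
  -- With `δ = η/(30L)`, the quadratic mismatch is at most `3δ(2L+1) ≤ 9Lδ ≤ η/3`.
  have hδ : 0 < η / (30 * L) := by positivity
  set s := √(1 / (2 * (5 * √5 / 4))) with hs
  have hs2 : s ^ 2 = 1 / (2 * (5 * √5 / 4)) := Real.sq_sqrt (by positivity)
  have hs0 : 0 ≤ s := Real.sqrt_nonneg _
  have h5l := lt_sqrt_five
  have h5u := sqrt_five_lt
  have hs1 : s ≤ 1 := by
    refine Real.sqrt_le_iff.2 ⟨zero_le_one, ?_⟩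
    rw [one_pow, div_le_one (by positivity)]
    linarith
  filter_upwards [eventually_abs_scaled_sub_le L hδ, eventually_ge_atTop 1,
    eventually_abs_log_A_sub_log_A_center_le (L + 1) (by positivity : 0 < η / 3),
    (tendsto_log_normalization.abs).eventually_le_const
      (by rw [abs_zero]; positivity : |(0 : ℝ)| < η / 3), eventually_sigma_pos]
    with n hscaled hn hlocal hnorm hσ k x hx hk
  have hxL := hx.trans hML
  have hsn : 0 < √(n : ℝ) := Real.sqrt_pos.2 (by exact_mod_cast hn)
  have hd := hscaled k x hxL hk
  set y := deviation n k / √n with hy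
  set δ := η / (30 * L) with hδdef
  have hδL : 30 * L * δ = η := by rw [hδdef]; field_simp
  have hδ1 : δ ≤ 1 / 30 := by nlinarith
  have hxs : |x * s| ≤ L := by
    rw [abs_mul, abs_of_nonneg hs0]
    nlinarith [abs_nonneg x]
  have hyL : |y| ≤ L + 1 := by
    have := abs_add_le (y - x * s) (x * s)
    rw [sub_add_cancel] at this
    linarith
  have hwin : |deviation n k| ≤ (L + 1) * √n := by
    rwa [hy, abs_div, abs_of_pos hsn, div_le_iff₀ hsn] at hyL
  obtain ⟨hk1, hk2, hlog⟩ := hlocal k hwin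
  rw [← hy] at hlog
  have hquad : |x ^ 2 / 2 - 5 * √5 / 4 * y ^ 2| ≤ η / 3 := by
    have e : x ^ 2 / 2 - 5 * √5 / 4 * y ^ 2 =
        -(5 * √5 / 4) * ((y - x * s) * (y + x * s)) := by
      have : 5 * √5 / 4 * s ^ 2 = 1 / 2 := by rw [hs2]; field_simp
      linear_combination (-x ^ 2) * this
    have h1 : |y + x * s| ≤ 2 * L + 1 := (abs_add_le _ _).trans (by linarith)
    rw [e, abs_mul, abs_neg, abs_mul, abs_of_pos (by positivity)]
    calc 5 * √5 / 4 * (|y - x * s| * |y + x * s|) ≤ 3 * (δ * (2 * L + 1)) := by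
          gcongr; linarith
      _ ≤ η / 3 := by nlinarith
  have hA : (0 : ℝ) < A n k := by exact_mod_cast A_pos hk1 hk2
  have hB := A_center_pos hn
  have hS := scaledMoment_zero_pos hn
  have hratio : (A n k : ℝ) / ((Nat.fib (2 * n) : ℝ) * (phi x / sigma n)) =
      Real.exp ((Real.log (A n k) - Real.log (A n (center n)) + 5 * √5 / 4 * y ^ 2) +
        (x ^ 2 / 2 - 5 * √5 / 4 * y ^ 2) +
        Real.log (√(2 * Real.pi) * (sigma n / √n) / scaledMoment 0 n)) := by
    rw [show (Real.log (A n k) - Real.log (A n (center n)) + 5 * √5 / 4 * y ^ 2) +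
        (x ^ 2 / 2 - 5 * √5 / 4 * y ^ 2) +
        Real.log (√(2 * Real.pi) * (sigma n / √n) / scaledMoment 0 n) =
        (Real.log (A n k) - Real.log (A n (center n))) + x ^ 2 / 2 +
        Real.log (√(2 * Real.pi) * (sigma n / √n) / scaledMoment 0 n) by ring,
      Real.exp_add, Real.exp_add, Real.exp_sub, Real.exp_log hA, Real.exp_log hB,
      Real.exp_log (by positivity), fib_eq hn, phi, neg_div, Real.exp_neg]
    field_simp
  rw [hratio]
  refine (Real.abs_exp_sub_one_le ?_).trans ?_
  all_goals
    have := (abs_add_three (Real.log (A n k) - Real.log (A n (center n)) + 5 * √5 / 4 * y ^ 2)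
      (x ^ 2 / 2 - 5 * √5 / 4 * y ^ 2)
      (Real.log (√(2 * Real.pi) * (sigma n / √n) / scaledMoment 0 n)))
    linarith

/-- Without nonnegativity the natural floor would truncate to 0 and could be farther than 1 from its
argument. -/
theorem eventually_mean_add_nonneg (M : ℝ) :
    ∀ᶠ n : ℕ in atTop, ∀ x : ℝ, |x| ≤ M → 0 ≤ mean n + x * sigma n := by
  have hlim := tendsto_mean.sub (tendsto_sigma.const_mul |M|)
  set l := 0 - |M| * √(1 / (2 * (5 * √5 / 4))) with hl
  filter_upwards [hlim.eventually_const_le (sub_one_lt l), eventually_ge_atTop 1,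
    eventually_const_le_sqrt (5 * (1 - l))] with n h hn hnl x hx
  have hsn : 0 < √(n : ℝ) := Real.sqrt_pos.2 (by exact_mod_cast hn)
  have hsq : √(n : ℝ) ^ 2 = n := Real.sq_sqrt (by positivity)
  have hσ : 0 ≤ sigma n := Real.sqrt_nonneg _
  have h1 : -|M| * sigma n ≤ x * sigma n := by
    gcongr
    exact neg_le_of_neg_le (by linarith [neg_abs_le x, le_abs_self M])
  rw [mul_div_assoc', ← sub_div, le_div_iff₀ hsn] at h
  nlinarith [lt_sqrt_five]

end MorganVoyce

/-- `A_{n,k} ~ F_{2n} φ(x) / σ_n` as `n → ∞`, uniformly for bounded `x`, where `k = μ_n + x σ_n`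
is an integer; and likewise for `k = ⌊μ_n + x σ_n⌋` with an arbitrary bounded real `x`. -/
theorem corollary4 :
    (∀ M : ℝ, ∀ ε : ℝ, 0 < ε → ∃ N : ℕ, ∀ n : ℕ, N ≤ n → ∀ (k : ℕ) (x : ℝ),
      |x| ≤ M → (k : ℝ) = MorganVoyce.mean n + x * MorganVoyce.sigma n →
        |(MorganVoyce.A n k : ℝ) /
          ((Nat.fib (2 * n) : ℝ) * (MorganVoyce.phi x / MorganVoyce.sigma n)) - 1| ≤ ε) ∧
    (∀ M : ℝ, ∀ ε : ℝ, 0 < ε → ∃ N : ℕ, ∀ n : ℕ, N ≤ n → ∀ x : ℝ, |x| ≤ M →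
        |(MorganVoyce.A n ⌊MorganVoyce.mean n + x * MorganVoyce.sigma n⌋₊ : ℝ) /
          ((Nat.fib (2 * n) : ℝ) * (MorganVoyce.phi x / MorganVoyce.sigma n)) - 1| ≤ ε) := by
  refine ⟨fun M ε hε => ?_, fun M ε hε => ?_⟩
  · obtain ⟨N, hN⟩ := Filter.eventually_atTop.1
      (MorganVoyce.eventually_abs_ratio_sub_one_le M hε)
    refine ⟨N, fun n hn k x hx hk => hN n hn k x hx ?_⟩
    rw [hk, sub_self, abs_zero]
    exact zero_le_one
  · obtain ⟨N, hN⟩ := Filter.eventually_atTop.1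
      ((MorganVoyce.eventually_abs_ratio_sub_one_le M hε).and
        (MorganVoyce.eventually_mean_add_nonneg M))
    exact ⟨N, fun n hn x hx => (hN n hn).1 _ x hx
      (MorganVoyce.abs_floor_sub_le ((hN n hn).2 x hx))⟩
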